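/- Let $K$ be a field of characteristic $0$ and $X$ a set. Identify the free magmatic algebra $\mathrm{Mag}(X)$ with the $K$-vector space spanned by planar binary trees with leaves decorated by $X$, the product of two trees being the grafting $T_1\vee T_2$ of $T_1$ (left) and $T_2$ (right) on a common root. Then the tensor bialgebra $T(\mathrm{Mag}(X))$ (concatenation product, trees primitive, coproduct $\Delta(h)=\sum h^{(1)}\otimes h^{(2)}$, counit $\varepsilon$) has the forests $F=T_1\cdots T_n$ of such trees as a basis; put $l(F)=n$. Let $*$ be the unique bilinear extension of $\vee$ to $T(\mathrm{Mag}(X))$ such that for all $f,g,h$ and all $y\in\mathrm{Mag}(X)$: $\varepsilon(f*g)=\varepsilon(f)\varepsilon(g)$, $\Delta(f*g)=\Delta(f)*\Delta(g)$, $f*1=f$, $1*f=\varepsilon(f)1$, $f*(gy)=(f*g)*y-f*(g*y)$, $(fg)*h=\sum(f*h^{(1)})(g*h^{(2)})$ and $(f*g)*h=\sum f*((g*h^{(1)})h^{(2)})$. For a forest $F=F_1\cdots F_m$ and a tree $S$ put $F\curvearrowleft S=\sum_{i=1}^m F_1\cdots(F_i\vee S)\cdots F_m$. For a forest $S=S_1\cdots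 S_n$ with $n\ge 2$ put $F\curvearrowleft S=(F\curvearrowleft S_1\cdots S_{n-1})*S_n$, and for the empty forest $1$ put $F\curvearrowleft 1=F$. For a word $w$ without repetitions over the positive integers, define a levelled tree (a planar binary tree with positive integer labels on its internal nodes, strictly increasing away from the root) by $\varphi(\emptyset)=|$ and $\varphi(w'\,m\,w'')=\varphi(w')\vee_m\varphi(w'')$, where $m$ is the smallest letter of $w'\,m\,w''$ and $\vee_m$ is grafting on a common root labelled $m$. For a forest $F=T_1\cdots T_n$ with $n\ge1$ and a levelled tree $T$ with $n-1$ nodes and pairwise distinct labels, normalised to $2,\dots,n$ by the order preserving relabelling, let $B(F,T)$ be the tree obtained by grafting $T_1$ on the leftmost leaf of $T$ and, for $2\le i\le n$, grafting $T_i$ on the closest leaf on the right of the node labelled $i$. For a forest $F=T_1\cdots T_k$ and a permutation $\sigma\in S_k$, let $O_1,\dots,O_r$ be the orbits of $\sigma$ on $\{1,\dots,k\}$, ordered by their minima. Let $\tau_s$ be the word $\sigma(m_s)\,\sigma^2(m_s)\cdots\sigma^{|O_s|-1}(m_s)$ with $m_s=\min O_s$ (the empty word if $|O_s|=1$), and let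 $F_{O_s}$ be the forest of the trees $T_i$ with $i\in O_s$, in increasing order of $i$. Put $\Phi_k(F)(\sigma)=B(F_{O_1},\varphi(\tau_1))\cdots B(F_{O_r},\varphi(\tau_r))$ and let $O(\sigma)=r$ be the number of orbits of $\sigma$ (fixed points included). Then for all forests $F,F'$ of planar binary trees with leaves decorated by $X$, with $l(F')=k$, $$F*F'=\sum_{\sigma\in S_k}(-1)^{O(\sigma)+k}\;F\curvearrowleft\Phi_k(F')(\sigma).$$ -/

import Mathlib

open scoped TensorProduct

/-! ## The tensor algebra and the extension of a magmatic product to it -/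

namespace TensorMag

noncomputable section

variable {K V : Type*} [CommRing K] [AddCommGroup V] [Module K V]

/-- The coproduct of the tensor bialgebra `T(V)`: the algebra morphism with
`Δ v = v ⊗ 1 + 1 ⊗ v` for `v ∈ V`. -/
def coproduct (K V : Type*) [CommRing K] [AddCommGroup V] [Module K V] :
    TensorAlgebra K V →ₐ[K] TensorAlgebra K V ⊗[K] TensorAlgebra K V :=
  TensorAlgebra.lift K
    (((TensorProduct.mk K (TensorAlgebra K V) (TensorAlgebra K V)).flip 1 +
      TensorProduct.mk K (TensorAlgebra K V) (TensorAlgebra K V) 1) ∘ₗ TensorAlgebra.ι K)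

/-- The counit of the tensor bialgebra `T(V)`. -/
abbrev counit (K V : Type*) [CommRing K] [AddCommGroup V] [Module K V] :
    TensorAlgebra K V →ₐ[K] K :=
  TensorAlgebra.algebraMapInv

end

/-- `p f g = f * g` is an extension of the magmatic product of `V` to the tensor algebra `T(V)`
with the properties that characterise *the* extended product.  In `comul` the product of `T(V)`
is extended to `T(V) ⊗ T(V)` factor by factor; in `mul_left` and `star_star` the right-hand sides
are `∑ (f * h⁽¹⁾) (g * h⁽²⁾)` and `∑ f * ((g * h⁽¹⁾) h⁽²⁾)`. -/
structure IsExtendedProduct {K V : Type*} [CommRing K] [NonUnitalNonAssocRing V] [Module K V]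
    (p : TensorAlgebra K V →ₗ[K] TensorAlgebra K V →ₗ[K] TensorAlgebra K V) : Prop where
  extends_mul : ∀ x y : V,
    p (TensorAlgebra.ι K x) (TensorAlgebra.ι K y) = TensorAlgebra.ι K (x * y)
  counit_star : ∀ f g, counit K V (p f g) = counit K V f * counit K V g
  comul_star : ∀ f g, coproduct K V (p f g) =
    TensorProduct.map₂ p p (coproduct K V f) (coproduct K V g)
  star_one : ∀ f, p f 1 = f
  one_star : ∀ f, p 1 f = counit K V f • 1
  star_mul_ι : ∀ (f g : TensorAlgebra K V) (y : V),
    p f (g * TensorAlgebra.ι K y) =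
      p (p f g) (TensorAlgebra.ι K y) - p f (p g (TensorAlgebra.ι K y))
  mul_star : ∀ f g h, p (f * g) h =
    LinearMap.mul' K (TensorAlgebra K V) (TensorProduct.map (p f) (p g) (coproduct K V h))
  star_star : ∀ f g h, p (p f g) h =
    p f (LinearMap.mul' K (TensorAlgebra K V)
      (TensorProduct.map (p g) LinearMap.id (coproduct K V h)))

end TensorMag

/-! ## Forests of planar binary trees with decorated leaves, and the extended product -/

namespace LeafForest

open TensorMag

/-- Planar binary trees with leaves decorated by `X`, i.e. nonassociative words on `X`:
`FreeMagma.of x` is the tree `|` with its leaf decorated by `x`, and the product `T₁ * T₂` of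
`FreeMagma X` is the grafting `T₁ ∨ T₂`. -/
abbrev LeafTree (X : Type*) := FreeMagma X

/-- Planar forests `T₁ ⋯ Tₙ`; the empty list is the empty forest. -/
abbrev Forest (X : Type*) := List (LeafTree X)

/-- The free magmatic algebra `Mag(X)`. -/
abbrev Mag (K X : Type*) [CommRing K] := FreeNonUnitalNonAssocAlgebra K X

/-- `T(Mag(X))`. -/
abbrev TMag (K X : Type*) [CommRing K] := TensorAlgebra K (Mag K X)

noncomputable section

variable (K : Type*) [CommRing K] {X : Type*}

/-- A tree as an element of `Mag(X) ⊆ T(Mag(X))`. -/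
def ofTree (T : LeafTree X) : TMag K X :=
  TensorAlgebra.ι K (MonoidAlgebra.ofMagma K (FreeMagma X) T)

/-- A forest `T₁ ⋯ Tₙ` as the element `T₁ ⊗ ⋯ ⊗ Tₙ` of `T(Mag(X))`. -/
def ofForest (F : Forest X) : TMag K X :=
  (F.map (ofTree K)).prod

/-- The basis of `Mag(X)` given by trees. -/
def treeBasis (K : Type*) [CommRing K] (X : Type*) : Module.Basis (LeafTree X) K (Mag K X) :=
  Module.Basis.ofRepr (MonoidAlgebra.coeffLinearEquiv K)

/-- The basis of `T(Mag(X))` given by forests. -/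
def forestBasis (K : Type*) [CommRing K] (X : Type*) : Module.Basis (Forest X) K (TMag K X) :=
  (treeBasis K X).tensorAlgebra

theorem treeBasis_apply (T : LeafTree X) :
    treeBasis K X T = MonoidAlgebra.ofMagma K (FreeMagma X) T :=
  rfl

theorem forestBasis_apply (F : Forest X) : forestBasis K X F = ofForest K F := by
  have h : FreeAlgebra.basisFreeMonoid K (FreeMagma X) F =
      (F.map (FreeAlgebra.ι K)).prod := by
    have h' : FreeAlgebra.basisFreeMonoid K (FreeMagma X) F =
        FreeAlgebra.equivMonoidAlgebraFreeMonoid.symm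
          (MonoidAlgebra.of K (FreeMonoid (FreeMagma X)) F) := rfl
    rw [h']
    induction F with
    | nil => exact map_one _
    | cons T F ih =>
      have e : MonoidAlgebra.of K (FreeMonoid (FreeMagma X)) (T :: F) =
        MonoidAlgebra.of K (FreeMonoid (FreeMagma X)) (FreeMonoid.of T) *
          MonoidAlgebra.of K (FreeMonoid (FreeMagma X)) F := map_mul _ (FreeMonoid.of T) F
      rw [e, map_mul, ih rfl, List.map_cons, List.prod_cons]
      congr 1
      simp [FreeAlgebra.equivMonoidAlgebraFreeMonoid]
  have h2 : forestBasis K X F = (TensorAlgebra.equivFreeAlgebra (treeBasis K X)).symm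
      (FreeAlgebra.basisFreeMonoid K (FreeMagma X) F) := rfl
  rw [h2, h, map_list_prod, List.map_map, ofForest]
  congr 2
  funext T
  rw [Function.comp_apply, TensorAlgebra.equivFreeAlgebra_symm_ι, treeBasis_apply, ofTree]

/-- `∑ᵢ F₁ ⋯ (Fᵢ ∨ T) ⋯ Fₖ`, the sum of all right grafts of the tree `T` on the forest
`F = F₁ ⋯ Fₖ`. -/
def graftTree (F : Forest X) (T : LeafTree X) : TMag K X :=
  ∑ i : Fin F.length, ofForest K (F.set i (F[i] * T))

/-- The linear extension of `F ↦ ∑ᵢ F₁ ⋯ (Fᵢ ∨ T) ⋯ Fₖ` to `T(Mag(X))`. -/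
def graftOp (T : LeafTree X) : TMag K X →ₗ[K] TMag K X :=
  (forestBasis K X).constr K fun F => graftTree K F T

/-- `f ↦ f * (Gₙ ⋯ G₁)` for a forest, listed here from its last tree to its first one:
`f * 1 = f` and `f * (G y) = (f * G) * y - f * (G * y)`. -/
def starRev : Forest X → (TMag K X →ₗ[K] TMag K X)
  | [] => LinearMap.id
  | y :: G => graftOp K y ∘ₗ starRev G - ∑ i : Fin G.length, starRev (G.set i (G[i] * y))
  termination_by G => G.length
  decreasing_by all_goals simp

/-- The extended product `f * g` on `T(Mag(X))`, as a bilinear map.  That it is the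
extension of the product of `Mag(X)` is `isExtendedProduct_iff` below. -/
def extStar (K X : Type*) [CommRing K] : TMag K X →ₗ[K] TMag K X →ₗ[K] TMag K X :=
  LinearMap.flip ((forestBasis K X).constr K fun G => starRev K G.reverse)

variable {K}

theorem ofForest_nil : ofForest K ([] : Forest X) = 1 := rfl

theorem ofForest_cons (T : LeafTree X) (F : Forest X) :
    ofForest K (T :: F) = ofTree K T * ofForest K F := by simp [ofForest]

theorem ofForest_append (F G : Forest X) :
    ofForest K (F ++ G) = ofForest K F * ofForest K G := by simp [ofForest]

theorem ofForest_singleton (T : LeafTree X) : ofForest K [T] = ofTree K T := by simp [ofForest]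

theorem graftTree_cons (T y : LeafTree X) (F : Forest X) : graftTree K (T :: F) y =
    ofTree K (T * y) * ofForest K F + ofTree K T * graftTree K F y := by
  simp only [graftTree, List.length_cons, Fin.sum_univ_succ, Finset.mul_sum, ← ofForest_cons]
  rfl

theorem graftTree_append (F G : Forest X) (y : LeafTree X) : graftTree K (F ++ G) y =
    graftTree K F y * ofForest K G + ofForest K F * graftTree K G y := by
  induction F with
  | nil => simp [graftTree, ofForest_nil]
  | cons T F ih =>
    simp only [List.cons_append, graftTree_cons, ih, ofForest_append, ofForest_cons]
    noncomm_ring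

theorem graftOp_ofForest (F : Forest X) (y : LeafTree X) :
    graftOp K y (ofForest K F) = graftTree K F y := by
  rw [← forestBasis_apply, graftOp, Module.Basis.constr_basis]

theorem graftOp_one (y : LeafTree X) : graftOp K y (1 : TMag K X) = 0 := by
  rw [← ofForest_nil, graftOp_ofForest]; simp [graftTree]

theorem graftOp_ofTree (T y : LeafTree X) : graftOp K y (ofTree K T) = ofTree K (T * y) := by
  rw [← ofForest_singleton, graftOp_ofForest, graftTree_cons]; simp [graftTree, ofForest_nil]

theorem graftOp_mul (y : LeafTree X) (f g : TMag K X) :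
    graftOp K y (f * g) = graftOp K y f * g + f * graftOp K y g := by
  have h : (LinearMap.mul K (TMag K X)).compr₂ (graftOp K y) =
      (LinearMap.mul K (TMag K X)) ∘ₗ graftOp K y +
        ((LinearMap.mul K (TMag K X)).compl₂ (graftOp K y)) := by
    refine (forestBasis K X).ext fun F => (forestBasis K X).ext fun G => ?_
    simp only [forestBasis_apply, LinearMap.compr₂_apply, LinearMap.mul_apply', LinearMap.add_apply,
      LinearMap.comp_apply, LinearMap.compl₂_apply]
    rw [← ofForest_append, graftOp_ofForest, graftTree_append, graftOp_ofForest, graftOp_ofForest]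
  exact LinearMap.congr_fun₂ h f g

theorem extStar_ofForest (f : TMag K X) (G : Forest X) :
    extStar K X f (ofForest K G) = starRev K G.reverse f := by
  rw [← forestBasis_apply, extStar, LinearMap.flip_apply, Module.Basis.constr_basis]

theorem extStar_one (f : TMag K X) : extStar K X f 1 = f := by
  rw [← ofForest_nil, extStar_ofForest]; simp [starRev]

theorem extStar_mul_ofTree (f g : TMag K X) (y : LeafTree X) :
    extStar K X f (g * ofTree K y) =
      graftOp K y (extStar K X f g) - extStar K X f (graftOp K y g) := by
  have h : extStar K X f ∘ₗ LinearMap.mulRight K (ofTree K y) =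
      graftOp K y ∘ₗ extStar K X f - extStar K X f ∘ₗ graftOp K y := by
    refine (forestBasis K X).ext fun G => ?_
    simp only [forestBasis_apply, LinearMap.sub_apply, LinearMap.comp_apply,
      LinearMap.mulRight_apply]
    rw [← ofForest_singleton, ← ofForest_append, extStar_ofForest, extStar_ofForest,
      graftOp_ofForest, List.reverse_append, List.reverse_singleton, List.singleton_append, starRev,
      graftTree, map_sum, LinearMap.sub_apply, LinearMap.comp_apply, LinearMap.sum_apply]
    congr 1
    refine Fintype.sum_equiv (Fin.revPerm.trans (finCongr G.length_reverse)) _ _ fun i => ?_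
    rw [extStar_ofForest]
    congr 2
    have hi : i.1 < G.length := i.2.trans_eq G.length_reverse
    refine List.ext_getElem (by simp) fun m h₁ h₂ => ?_
    have hm : m < G.length := by simpa using h₁
    have hc : i.1 = m ↔ G.length - (i.1 + 1) = G.length - 1 - m := by omega
    simp only [List.getElem_set, List.getElem_reverse, Fin.getElem_fin, Equiv.trans_apply,
      Fin.revPerm_apply, finCongr_apply, Fin.val_cast, Fin.val_rev, List.length_reverse,
      List.length_set, hc]
    grind
  exact LinearMap.congr_fun h g

theorem extStar_ofTree (f : TMag K X) (y : LeafTree X) :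
    extStar K X f (ofTree K y) = graftOp K y f := by
  have h := extStar_mul_ofTree f 1 y
  simpa [extStar_one, graftOp_one] using h

/-- A linear map on `T(Mag(X))` is determined by its value at `1` and by the values at `g y` in
terms of the values on shorter forests. -/
theorem linearMap_ext_of_rec {B : Type*} [AddCommGroup B] [Module K B]
    (d : LeafTree X → B → B) (P Q : TMag K X →ₗ[K] B) (h1 : P 1 = Q 1)
    (hP : ∀ g y, P (g * ofTree K y) = d y (P g) - P (graftOp K y g))
    (hQ : ∀ g y, Q (g * ofTree K y) = d y (Q g) - Q (graftOp K y g)) : P = Q := by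
  have key : ∀ n, ∀ G : Forest X, G.length = n → P (ofForest K G) = Q (ofForest K G) := by
    intro n
    induction n with
    | zero =>
      intro G hG
      rw [List.length_eq_zero_iff.1 hG, ofForest_nil, h1]
    | succ n ih =>
      intro G hG
      obtain rfl | ⟨G', y, rfl⟩ := List.eq_nil_or_concat' G
      · simp at hG
      have hl : G'.length = n := by simpa using hG
      rw [ofForest_append, ofForest_singleton, hP, hQ, ih G' hl, graftOp_ofForest, graftTree,
        map_sum, map_sum]
      congr 1
      exact Finset.sum_congr rfl fun i _ => ih _ (by simp [hl])
  exact (forestBasis K X).ext fun G => by rw [forestBasis_apply]; exact key _ G rfl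

theorem coproduct_ofTree (y : LeafTree X) : coproduct K (Mag K X) (ofTree K y) =
    ofTree K y ⊗ₜ[K] 1 + 1 ⊗ₜ[K] ofTree K y := by
  simp [coproduct, ofTree]

theorem counit_ofTree (y : LeafTree X) : counit K (Mag K X) (ofTree K y) = 0 := by
  simp [counit, ofTree, TensorAlgebra.algebraMapInv]

theorem counit_graftOp (y : LeafTree X) (g : TMag K X) :
    counit K (Mag K X) (graftOp K y g) = 0 := by
  have h : (counit K (Mag K X)).toLinearMap ∘ₗ graftOp K y = 0 := by
    refine (forestBasis K X).ext fun G => ?_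
    simp only [forestBasis_apply, LinearMap.comp_apply, AlgHom.toLinearMap_apply,
      LinearMap.zero_apply, graftOp_ofForest]
    induction G with
    | nil => simp [graftTree]
    | cons T G ih => simp [graftTree_cons, counit_ofTree]
  exact LinearMap.congr_fun h g

/-- The coderivation `D ⊗ 1 + 1 ⊗ D` of `T(Mag(X)) ⊗ T(Mag(X))`. -/
def graftOp₂ (y : LeafTree X) : TMag K X ⊗[K] TMag K X →ₗ[K] TMag K X ⊗[K] TMag K X :=
  (graftOp K y).rTensor (TMag K X) + (graftOp K y).lTensor (TMag K X)

theorem graftOp₂_tmul (y : LeafTree X) (a b : TMag K X) :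
    graftOp₂ y (a ⊗ₜ[K] b) = graftOp K y a ⊗ₜ[K] b + a ⊗ₜ[K] graftOp K y b := by
  simp [graftOp₂]

theorem graftOp₂_mul (y : LeafTree X) (s t : TMag K X ⊗[K] TMag K X) :
    graftOp₂ y (s * t) = graftOp₂ y s * t + s * graftOp₂ y t := by
  induction s with
  | zero => simp
  | add s₁ s₂ h₁ h₂ => simp only [add_mul, map_add, h₁, h₂]; abel
  | tmul a b =>
    induction t with
    | zero => simp
    | add s₁ s₂ h₁ h₂ => simp only [mul_add, map_add, h₁, h₂]; abel
    | tmul c d =>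
      simp only [Algebra.TensorProduct.tmul_mul_tmul, graftOp₂_tmul, graftOp_mul, add_mul, mul_add,
        TensorProduct.add_tmul, TensorProduct.tmul_add]
      abel

theorem coproduct_graftOp (y : LeafTree X) (g : TMag K X) :
    coproduct K (Mag K X) (graftOp K y g) = graftOp₂ y (coproduct K (Mag K X) g) := by
  have h : (coproduct K (Mag K X)).toLinearMap ∘ₗ graftOp K y =
      graftOp₂ y ∘ₗ (coproduct K (Mag K X)).toLinearMap := by
    refine (forestBasis K X).ext fun G => ?_
    simp only [forestBasis_apply, LinearMap.comp_apply, AlgHom.toLinearMap_apply]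
    induction G with
    | nil =>
      simp [ofForest_nil, graftOp_one, Algebra.TensorProduct.one_def, graftOp₂_tmul]
    | cons T G ih =>
      rw [ofForest_cons, graftOp_mul, map_add, map_mul, map_mul, map_mul, ih, graftOp₂_mul,
        graftOp_ofTree, coproduct_ofTree, coproduct_ofTree]
      simp [graftOp₂_tmul, graftOp_ofTree, graftOp_one]
  exact LinearMap.congr_fun h g

/-- The comparison used for the identities of the extended product that involve the coproduct of
the second argument. -/
theorem eq_comp_coproduct {B : Type*} [AddCommGroup B] [Module K B]
    (d : LeafTree X → B →ₗ[K] B) (P : TMag K X →ₗ[K] B) (Q : TMag K X ⊗[K] TMag K X →ₗ[K] B)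
    (h1 : P 1 = Q (1 ⊗ₜ 1))
    (hP : ∀ g y, P (g * ofTree K y) = d y (P g) - P (graftOp K y g))
    (hQ : ∀ a b y, Q ((a * ofTree K y) ⊗ₜ b) + Q (a ⊗ₜ (b * ofTree K y)) =
      d y (Q (a ⊗ₜ b)) - (Q (graftOp K y a ⊗ₜ b) + Q (a ⊗ₜ graftOp K y b))) (g : TMag K X) :
    P g = Q (coproduct K (Mag K X) g) := by
  have hQ' : ∀ t y, Q (t * coproduct K (Mag K X) (ofTree K y)) =
      d y (Q t) - Q (graftOp₂ y t) := by
    intro t y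
    induction t with
    | zero => simp
    | add s t hs ht => simp only [add_mul, map_add, hs, ht]; abel
    | tmul a b =>
      rw [coproduct_ofTree, mul_add, map_add, graftOp₂_tmul, map_add]
      simpa using hQ a b y
  have h := linearMap_ext_of_rec (fun y => d y) P (Q ∘ₗ (coproduct K (Mag K X)).toLinearMap)
    (by simpa [Algebra.TensorProduct.one_def] using h1) hP
    (by intro g y; simp only [LinearMap.comp_apply, AlgHom.toLinearMap_apply, map_mul, hQ',
          coproduct_graftOp])
  exact LinearMap.congr_fun h g

theorem isExtendedProduct_extStar : IsExtendedProduct (extStar K X) where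
  extends_mul x y := by
    have h : ((extStar K X).compl₁₂ (TensorAlgebra.ι K) (TensorAlgebra.ι K)) =
        (LinearMap.mul K (Mag K X)).compr₂ (TensorAlgebra.ι K) := by
      refine (treeBasis K X).ext fun T => (treeBasis K X).ext fun T' => ?_
      have := (extStar_ofTree (ofTree K T) T').trans (graftOp_ofTree T T')
      simpa [treeBasis_apply, ofTree] using this
    exact LinearMap.congr_fun₂ h x y
  counit_star f g := by
    have h := linearMap_ext_of_rec (fun _ _ => 0)
      ((counit K (Mag K X)).toLinearMap ∘ₗ extStar K X f)
      (counit K (Mag K X) f • (counit K (Mag K X)).toLinearMap)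
      (by simp [extStar_one])
      (by
        intro g y
        simp only [LinearMap.comp_apply, AlgHom.toLinearMap_apply, extStar_mul_ofTree, map_sub,
          counit_graftOp])
      (by
        intro g y
        simp [counit_ofTree, counit_graftOp])
    exact LinearMap.congr_fun h g
  comul_star f g := by
    refine eq_comp_coproduct (fun y => graftOp₂ y)
      ((coproduct K (Mag K X)).toLinearMap ∘ₗ extStar K X f)
      (TensorProduct.map₂ (extStar K X) (extStar K X) (coproduct K (Mag K X) f)) ?_ ?_ ?_ g
    · simp only [LinearMap.comp_apply, AlgHom.toLinearMap_apply, extStar_one]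
      generalize coproduct K (Mag K X) f = s
      induction s with
      | zero => simp
      | add s t hs ht => simp only [map_add, LinearMap.add_apply, ← hs, ← ht]
      | tmul a b => simp [extStar_one]
    · intro g y
      simp only [LinearMap.comp_apply, AlgHom.toLinearMap_apply, extStar_mul_ofTree, map_sub,
        coproduct_graftOp]
    · intro a b y
      generalize coproduct K (Mag K X) f = s
      induction s with
      | zero => simp
      | add s t hs ht =>
        simp only [map_add, LinearMap.add_apply]
        rw [add_add_add_comm, hs, ht]; abel
      | tmul c d =>
        simp only [TensorProduct.map₂_apply_tmul, TensorProduct.map_tmul, extStar_mul_ofTree,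
          graftOp₂_tmul, TensorProduct.sub_tmul, TensorProduct.tmul_sub]
        abel
  star_one := extStar_one
  one_star f := by
    have h := linearMap_ext_of_rec (fun y => graftOp K y) (extStar K X 1)
      ((counit K (Mag K X)).toLinearMap.smulRight 1)
      (by simp [extStar_one])
      (extStar_mul_ofTree 1)
      (by
        intro g y
        simp [counit_ofTree, counit_graftOp, graftOp_one])
    exact LinearMap.congr_fun h f
  star_mul_ι f g y := by
    have h : (extStar K X f) ∘ₗ (LinearMap.mul K (TMag K X) g) ∘ₗ TensorAlgebra.ι K =
        (extStar K X (extStar K X f g)) ∘ₗ TensorAlgebra.ι K -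
          (extStar K X f) ∘ₗ (extStar K X g) ∘ₗ TensorAlgebra.ι K := by
      refine (treeBasis K X).ext fun T => ?_
      have := extStar_mul_ofTree f g T
      rw [← extStar_ofTree, ← extStar_ofTree] at this
      exact this
    exact LinearMap.congr_fun h y
  mul_star f g h := by
    refine eq_comp_coproduct (fun y => graftOp K y) (extStar K X (f * g))
      (LinearMap.mul' K (TMag K X) ∘ₗ TensorProduct.map (extStar K X f) (extStar K X g)) ?_ ?_ ?_ h
    · simp [extStar_one]
    · exact extStar_mul_ofTree _
    · intro a b y
      simp only [LinearMap.comp_apply, TensorProduct.map_tmul, LinearMap.mul'_apply,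
        extStar_mul_ofTree, graftOp_mul]
      noncomm_ring
  star_star f g h := by
    refine eq_comp_coproduct (fun y => graftOp K y) (extStar K X (extStar K X f g))
      (extStar K X f ∘ₗ LinearMap.mul' K (TMag K X) ∘ₗ
        TensorProduct.map (extStar K X g) LinearMap.id) ?_ ?_ ?_ h
    · simp [extStar_one]
    · exact extStar_mul_ofTree _
    · intro a b y
      simp only [LinearMap.comp_apply, TensorProduct.map_tmul, LinearMap.mul'_apply,
        LinearMap.id_apply]
      rw [← mul_assoc, extStar_mul_ofTree f, extStar_mul_ofTree g, graftOp_mul, sub_mul, map_sub,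
        map_add]
      abel

/-- The bilinear map `extStar` is the unique extended product on `T(Mag(X))`. -/
theorem isExtendedProduct_iff (p : TMag K X →ₗ[K] TMag K X →ₗ[K] TMag K X) :
    IsExtendedProduct p ↔ p = extStar K X := by
  refine ⟨fun hp => ?_, fun h => h ▸ isExtendedProduct_extStar⟩
  have hD : ∀ y f, p f (ofTree K y) = graftOp K y f := by
    intro y f
    have h : p.flip (ofTree K y) = graftOp K y := by
      refine (forestBasis K X).ext fun F => ?_
      rw [forestBasis_apply, LinearMap.flip_apply]
      induction F with
      | nil => rw [ofForest_nil, hp.one_star, counit_ofTree, zero_smul, graftOp_one]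
      | cons T F ih =>
        rw [ofForest_cons, hp.mul_star, coproduct_ofTree, graftOp_mul, graftOp_ofTree, ← ih]
        have := hp.extends_mul (MonoidAlgebra.ofMagma K (FreeMagma X) T)
          (MonoidAlgebra.ofMagma K (FreeMagma X) y)
        rw [← map_mul] at this
        rw [← ofTree, ← ofTree, ← ofTree] at this
        simp [hp.star_one, this]
    exact LinearMap.congr_fun h f
  refine LinearMap.ext fun f => ?_
  refine linearMap_ext_of_rec (fun y => graftOp K y) _ _ ?_ ?_ ?_
  · rw [hp.star_one, extStar_one]
  · intro g y
    have := hp.star_mul_ι f g (MonoidAlgebra.ofMagma K (FreeMagma X) y)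
    rw [← ofTree, hD, hD] at this
    exact this
  · exact fun g y => extStar_mul_ofTree f g y

variable (K)

/-- `F ↶ S` for forests `F` and `S = S₁ ⋯ Sₙ`: it is the sum of all right grafts of `S₁` on `F`
if `n = 1`, and `(F ↶ S₁ ⋯ Sₙ₋₁) * Sₙ` if `n ≥ 2`; for the empty forest `F ↶ 1 = F`. -/
def graftForest (F : Forest X) : Forest X → TMag K X
  | [] => ofForest K F
  | S :: R => R.foldl (fun f T => extStar K X f (ofTree K T)) (graftTree K F S)

end

/-! ## Levelled trees, and the map from permutations to forests

A planar binary tree `t` with a node decoration `Vertex(t) → ℕ` is a `BinaryTree ℕ`: `nil` is the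
tree `|` and `node n t₁ t₂` is `t₁ ∨ₙ t₂`. -/

open BinaryTree

/-- The set of the labels of the nodes. -/
def labels : BinaryTree ℕ → Finset ℕ
  | nil => ∅
  | node n l r => insert n (labels l ∪ labels r)

/-- Levelled trees: the labels are positive, and they strictly increase along every path from the
root to the leaves. -/
def IsLevelled : BinaryTree ℕ → Prop
  | nil => True
  | node n l r => 0 < n ∧ (∀ m ∈ labels l ∪ labels r, n < m) ∧ IsLevelled l ∧ IsLevelled r

/-- `φ(0) = |` for the empty word, and `φ(w' m w'') = φ(w') ∨ₘ φ(w'')` where `m` is the smallest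
letter of the word `w' m w''` (a word without repetitions). -/
def wordTree : List ℕ → BinaryTree ℕ
  | [] => nil
  | a :: l =>
    let w := a :: l
    let m := w.min (List.cons_ne_nil a l)
    node m (wordTree (w.take (w.idxOf m))) (wordTree (w.drop (w.idxOf m + 1)))
  termination_by w => w.length
  decreasing_by
    · have := List.idxOf_lt_length_of_mem (List.min_mem (List.cons_ne_nil a l))
      simp only [List.length_take]
      omega
    · simp only [List.length_drop, List.length_cons]
      omega

theorem labels_wordTree (w : List ℕ) : labels (wordTree w) ⊆ w.toFinset := by
  induction w using wordTree.induct with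
  | case1 => simp [wordTree, labels]
  | case2 a l w m h₁ =>
    rename_i h₂
    have hm : m ∈ w := List.min_mem _
    rw [wordTree]
    intro x hx
    simp only [labels, Finset.mem_insert, Finset.mem_union] at hx
    rw [List.mem_toFinset]
    rcases hx with rfl | hx | hx
    · exact hm
    · exact List.mem_of_mem_take (List.mem_toFinset.1 (h₁ hx))
    · exact List.mem_of_mem_drop (List.mem_toFinset.1 (h₂ hx))

/-- `φ` sends words without repetitions over the positive integers to levelled trees. -/
theorem isLevelled_wordTree (w : List ℕ) (hw : w.Nodup) (h0 : ∀ a ∈ w, 0 < a) :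
    IsLevelled (wordTree w) := by
  induction w using wordTree.induct with
  | case1 => simp [wordTree, IsLevelled]
  | case2 a l w m h₁ =>
    rename_i h₂
    have hm : m ∈ w := List.min_mem _
    have hlt := List.idxOf_lt_length_of_mem hm
    have hsplit : w = w.take (w.idxOf m) ++ m :: w.drop (w.idxOf m + 1) := by
      conv_lhs => rw [← List.take_append_drop (w.idxOf m) w, List.drop_eq_getElem_cons hlt]
      simp
    have hn := hw
    change w.Nodup at hn
    rw [hsplit, List.nodup_middle, List.nodup_cons] at hn
    rw [wordTree]
    refine ⟨h0 m hm, ?_, h₁ (hw.sublist (List.take_sublist _ _))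
      (fun a ha => h0 a (List.mem_of_mem_take ha)), h₂ (hw.sublist (List.drop_sublist _ _))
      (fun a ha => h0 a (List.mem_of_mem_drop ha))⟩
    intro x hx
    have hx' : x ∈ w.take (w.idxOf m) ++ w.drop (w.idxOf m + 1) := by
      rw [List.mem_append]
      rcases Finset.mem_union.1 hx with h | h
      · exact Or.inl (List.mem_toFinset.1 (labels_wordTree _ h))
      · exact Or.inr (List.mem_toFinset.1 (labels_wordTree _ h))
    have hxw : x ∈ w := by
      rcases List.mem_append.1 hx' with h | h
      · exact List.mem_of_mem_take h
      · exact List.mem_of_mem_drop h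
    refine lt_of_le_of_ne (List.min_le_of_mem hxw) ?_
    rintro rfl
    exact hn.1 hx'

/-- The order preserving relabelling of a levelled tree with pairwise distinct labels and `n - 1`
nodes by the labels `2, …, n`. -/
def standardize (T : BinaryTree ℕ) : BinaryTree ℕ :=
  T.map fun a => ((labels T).filter (· ≤ a)).card + 1

/-- Graft `t` on the leftmost leaf, and for each node graft `g i`, where `i` is the label of the
node, on the closest leaf on the right of this node, which is the leftmost leaf of its right
subtree. -/
def fillLeaves {X : Type*} (g : ℕ → LeafTree X) : BinaryTree ℕ → LeafTree X → LeafTree X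
  | nil, t => t
  | node i l r, t => fillLeaves g l t * fillLeaves g r (g i)

/-- `B(F, T)` for a forest `F = T₁ ⋯ Tₙ` with `n ≥ 1` and a levelled tree `T` with set of labels
`{2, …, n}`: graft `T₁` on the leftmost leaf of `T`, and `Tᵢ` on the closest leaf on the right of
the node with label `i`. (For other labels the value is irrelevant.) -/
def graftLevelled {X : Type*} (F : Forest X) (hF : F ≠ []) (T : BinaryTree ℕ) : LeafTree X :=
  fillLeaves (fun i => F.getD (i - 1) (F.head hF)) T (F.head hF)

/-- `F_I = T_{i₁} ⋯ T_{iₗ}` for `F = T₁ ⋯ Tₙ` and a set `I = {i₁ < ⋯ < iₗ}` of positions. -/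
def subforest {X : Type*} (F : Forest X) (I : Finset (Fin F.length)) : Forest X :=
  ((List.finRange F.length).filter (· ∈ I)).map F.get

theorem subforest_ne_nil {X : Type*} (F : Forest X) (I : Finset (Fin F.length))
    (i : Fin F.length) (hi : i ∈ I) : subforest F I ≠ [] := by
  apply List.ne_nil_of_mem (a := F.get i)
  exact List.mem_map_of_mem (by simpa using hi)

/-! The element `i : Fin n` stands for the element `i + 1` of `{1, …, n}`. -/

/-- The orbit of `i` under the permutation `σ`. -/
def orbit {n : ℕ} (σ : Equiv.Perm (Fin n)) (i : Fin n) : Finset (Fin n) :=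
  Finset.univ.filter fun j => σ.SameCycle i j

theorem mem_orbit_self {n : ℕ} (σ : Equiv.Perm (Fin n)) (i : Fin n) : i ∈ orbit σ i := by
  simp [orbit, Equiv.Perm.SameCycle.refl]

/-- The minima of the orbits of `σ`, in increasing order. -/
def orbitMins {n : ℕ} (σ : Equiv.Perm (Fin n)) : List (Fin n) :=
  (List.finRange n).filter fun i => ∀ j ∈ orbit σ i, i ≤ j

/-- For the minimum `i` of an orbit of `σ`, the word `τ` over `{1, …, n}` such that `i τ` is the
normal form `i, σ(i), σ²(i), …` of the cycle of `σ` on that orbit; it is empty if `σ(i) = i`. -/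
def cycleWord {n : ℕ} (σ : Equiv.Perm (Fin n)) (i : Fin n) : List ℕ :=
  (σ.toList i).tail.map fun j => (j : ℕ) + 1

/-- The number `O(σ)` of orbits of `σ`. -/
noncomputable def numOrbits {n : ℕ} (σ : Equiv.Perm (Fin n)) : ℕ :=
  Nat.card (MulAction.orbitRel.Quotient (Subgroup.zpowers σ) (Fin n))

/-- `Φₙ(F)(σ) = B(F_{O₁}, φ(τ₁)) ⋯ B(F_{Oᵣ}, φ(τᵣ))` for a forest `F` of length `n` and a
permutation `σ` of `{1, …, n}`, where `O₁, …, Oᵣ` are the orbits of `σ` ordered by their minima and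
`min(Oₛ) τₛ` is the normal form of the cycle of `σ` on `Oₛ`.  The labels of `φ(τₛ)`, which are the
elements of `Oₛ` other than its minimum, are first normalised to `2, …, |Oₛ|`. -/
def permForest {X : Type*} (F : Forest X) (σ : Equiv.Perm (Fin F.length)) : Forest X :=
  (orbitMins σ).map fun i =>
    graftLevelled (subforest F (orbit σ i)) (subforest_ne_nil F _ i (mem_orbit_self σ i))
      (standardize (wordTree (cycleWord σ i)))

end LeafForest

namespace LeafForest

open BinaryTree

/-! ### Words, levelled trees and the insertion of a largest letter -/

section Words

variable {X : Type*}

/-! The formula is proved by induction on the length of the second forest, through the recursion `f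
* (G y) = (f * G) * y - f * (G * y)`. Right multiplication by a tree `y` is the derivation `graftOp
K y`, so `G * y` is the sum over `j` of the forests in which the tree `G_j` is replaced by `G_j ∨
y`. All of these are as long as `G`, and the induction hypothesis applies to them.

Permutations obey the same recursion (`sum_perm_succ`): a permutation of `n + 1` points either fixes
the last point, or arises from a unique permutation `σ` of `n` points by inserting the last point
right after some `j` in its cycle. In the first case `Φ` gains the factor `y` at its end, and both
the number of orbits and the length grow by one, so the sign is kept: this is `(f * G) * y`. In the
second case only the length grows, so the sign flips, and `Φ` equals `Φ(σ)` for the forest with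
`G_j` replaced by `G_j ∨ y` (`permTrees_insertLast`): this is `- f * (G * y)`.

The last statement rests on a property of `φ`: a letter larger than all others becomes a node with
two leaves. If it is inserted right after `i`, that node sits on the leaf that receives the tree of
`i` (`fillWord_insert_max`); if it comes first, it sits on the leftmost leaf (`fillWord_cons_max`),
which is the case where `j` is the minimum of its orbit. The normalisation of labels in `B` is
removed by `permForest_eq_permTrees`. -/

theorem wordTree_append_cons (u v : List ℕ) (m : ℕ) (hu : ∀ a ∈ u, m < a) (hv : ∀ a ∈ v, m < a) :
    wordTree (u ++ m :: v) = node m (wordTree u) (wordTree v) := by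
  obtain ⟨a, l, h⟩ := List.exists_cons_of_ne_nil (l := u ++ m :: v) (by simp)
  have hmin : (a :: l).min (List.cons_ne_nil a l) = m := by
    refine le_antisymm (List.min_le_of_mem (by rw [← h]; simp)) ?_
    have : (a :: l).min (List.cons_ne_nil a l) ∈ u ++ m :: v := by
      rw [h]
      exact List.min_mem _
    rcases List.mem_append.1 this with h' | h'
    · exact (hu _ h').le
    · rcases List.mem_cons.1 h' with h' | h'
      · exact h'.ge
      · exact (hv _ h').le
  have hmu : m ∉ u := fun hm => lt_irrefl _ (hu m hm)
  have hidx : (u ++ m :: v).idxOf m = u.length := by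
    rw [List.idxOf_append_of_notMem hmu]; simp
  rw [h, wordTree, hmin, ← h, hidx]
  simp

theorem exists_min_split (w : List ℕ) (hw : w.Nodup) (h : w ≠ []) :
    ∃ u m v, w = u ++ m :: v ∧ (∀ a ∈ u, m < a) ∧ ∀ a ∈ v, m < a := by
  obtain ⟨u, v, huv⟩ := List.append_of_mem (List.min_mem h)
  have hn := hw
  rw [huv, List.nodup_middle, List.nodup_cons, List.mem_append, not_or] at hn
  refine ⟨u, _, v, huv, fun a ha => ?_, fun a ha => ?_⟩
  · refine lt_of_le_of_ne (List.min_le_of_mem (by rw [huv]; simp [ha])) ?_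
    intro e
    exact hn.1.1 (by rwa [e])
  · refine lt_of_le_of_ne (List.min_le_of_mem (by rw [huv]; simp [ha])) ?_
    intro e
    exact hn.1.2 (by rwa [e])

/-- Every word without repetitions is built from the empty word by splitting at its minimum. -/
theorem min_split_induction {P : ∀ w : List ℕ, w.Nodup → Prop} (h0 : P [] List.nodup_nil)
    (h1 : ∀ u m v, ∀ h : (u ++ m :: v).Nodup, (∀ a ∈ u, m < a) → (∀ a ∈ v, m < a) →
      P u (h.sublist (List.sublist_append_left _ _)) →
      P v (h.sublist ((List.sublist_cons_self _ _).trans (List.sublist_append_right _ _))) →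
      P (u ++ m :: v) h) (w : List ℕ) (hw : w.Nodup) : P w hw := by
  induction hl : w.length using Nat.strong_induction_on generalizing w with
  | _ n ih =>
    by_cases h : w = []
    · subst h
      exact h0
    · obtain ⟨u, m, v, rfl, hu, hv⟩ := exists_min_split w hw h
      simp only [List.length_append, List.length_cons] at hl
      exact h1 u m v hw hu hv (ih u.length (by omega) u _ rfl) (ih v.length (by omega) v _ rfl)

theorem labels_wordTree_eq (w : List ℕ) (hw : w.Nodup) : labels (wordTree w) = w.toFinset := by
  induction w, hw using min_split_induction with
  | h0 => simp [wordTree, labels]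
  | h1 u m v _ hu hv ihu ihv =>
    rw [wordTree_append_cons u v m hu hv, labels, ihu, ihv]
    ext a
    simp

theorem fillLeaves_congr {g h : ℕ → LeafTree X} (T : BinaryTree ℕ) (t : LeafTree X)
    (H : ∀ a ∈ labels T, g a = h a) : fillLeaves g T t = fillLeaves h T t := by
  induction T generalizing t with
  | nil => rfl
  | node n l r ihl ihr =>
    simp only [labels, Finset.mem_insert, Finset.mem_union] at H
    simp only [fillLeaves]
    rw [ihl t fun a ha => H a (Or.inr (Or.inl ha)), H n (Or.inl rfl),
      ihr _ fun a ha => H a (Or.inr (Or.inr ha))]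

/-- Lets a relabelling such as `standardize` be absorbed into the choice of the grafted trees. -/
theorem fillLeaves_map (g : ℕ → LeafTree X) (f : ℕ → ℕ) (T : BinaryTree ℕ) (t : LeafTree X) :
    fillLeaves g (T.map f) t = fillLeaves (g ∘ f) T t := by
  induction T generalizing t with
  | nil => rfl
  | node n l r ihl ihr => simp [BinaryTree.map, fillLeaves, ihl, ihr]

/-- The leaves of `φ(w)` are filled with `t` and with the trees `g a` for the letters `a` of `w`. -/
def fillWord (g : ℕ → LeafTree X) (w : List ℕ) (t : LeafTree X) : LeafTree X :=
  fillLeaves g (wordTree w) t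

theorem fillWord_nil (g : ℕ → LeafTree X) (t : LeafTree X) : fillWord g [] t = t := by
  simp [fillWord, wordTree, fillLeaves]

theorem fillWord_append_cons (g : ℕ → LeafTree X) {u v : List ℕ} {m : ℕ} (hu : ∀ a ∈ u, m < a)
    (hv : ∀ a ∈ v, m < a) (t : LeafTree X) :
    fillWord g (u ++ m :: v) t = fillWord g u t * fillWord g v (g m) := by
  rw [fillWord, wordTree_append_cons u v m hu hv, fillLeaves]; rfl

theorem fillWord_congr {g h : ℕ → LeafTree X} {w : List ℕ} (t : LeafTree X)
    (H : ∀ a ∈ w, g a = h a) : fillWord g w t = fillWord h w t :=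
  fillLeaves_congr _ _ fun a ha => H a (List.mem_toFinset.1 (labels_wordTree w ha))

/-- Inserting a letter larger than all others in front of a word. -/
theorem fillWord_cons_max (g : ℕ → LeafTree X) (k : ℕ) (w : List ℕ) (hw : w.Nodup)
    (hk : ∀ a ∈ w, a < k) (t : LeafTree X) : fillWord g (k :: w) t = fillWord g w (t * g k) := by
  induction w, hw using min_split_induction with
  | h0 =>
    have := fillWord_append_cons g (u := []) (v := []) (m := k) (by simp) (by simp) t
    simpa [fillWord_nil] using this
  | h1 u m v _ hu hv ihu ihv =>
    have hmk : m < k := hk m (by simp)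
    have hu' : ∀ a ∈ k :: u, m < a := by simpa using ⟨hmk, hu⟩
    -- Since `m < k`, the root stays `m` and `k` only enters the left subword.
    rw [← List.cons_append, fillWord_append_cons g hu' hv, fillWord_append_cons g hu hv,
      ihu fun a ha => hk a (by simp [ha])]

/-- Inserting a letter larger than all others right after the letter `i`. -/
theorem fillWord_insert_max (g : ℕ → LeafTree X) (k i : ℕ) (w : List ℕ) (hw : w.Nodup)
    (hk : ∀ a ∈ w, a < k) (x y : List ℕ) (hxy : w = x ++ i :: y) (t : LeafTree X) :
    fillWord g (x ++ i :: k :: y) t = fillWord (Function.update g i (g i * g k)) w t := by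
  induction w, hw using min_split_induction generalizing x y t with
  | h0 => simp at hxy
  | h1 u m v hn hu hv ihu ihv =>
    have hmk : m < k := hk m (by simp)
    rw [fillWord_append_cons _ hu hv]
    rw [List.nodup_middle, List.nodup_cons, List.mem_append, not_or, List.nodup_append] at hn
    obtain ⟨⟨hmu, hmv⟩, hnu, hnv, hd⟩ := hn
    have hupd : ∀ s : List ℕ, i ∉ s → ∀ t, fillWord (Function.update g i (g i * g k)) s t =
        fillWord g s t := fun s hs t => fillWord_congr t fun a ha =>
      Function.update_of_ne (by rintro rfl; exact hs ha) _ _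
    -- The letter `i` is the minimum `m`, or lies in `v`, or lies in `u`. The case `i = m` occurs in
    -- both alternatives, with `c` empty; there `k` becomes the first letter of the right subword.
    rcases List.append_eq_append_iff.1 hxy with ⟨c, hc1, hc2⟩ | ⟨c, hc1, hc2⟩
    · cases c with
      | nil =>
        simp only [List.nil_append, List.cons.injEq] at hc2
        obtain ⟨rfl, rfl⟩ := hc2
        simp only [List.append_nil] at hc1
        subst hc1
        rw [fillWord_append_cons g hu (by simpa using ⟨hmk, hv⟩), hupd _ hmu, hupd _ hmv,
          fillWord_cons_max g k v hnv (fun a ha => hk a (by simp [ha])), Function.update_self]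
      | cons b c =>
        simp only [List.cons_append, List.cons.injEq] at hc2
        obtain ⟨rfl, rfl⟩ := hc2
        subst hc1
        have hiu : i ∉ u := fun h => hd i h i (by simp) rfl
        have hmi : m ≠ i := fun h => hmv (by simp [h])
        have hv' : ∀ a ∈ c ++ i :: k :: y, m < a := by
          intro a ha
          by_cases hak : a = k
          · rwa [hak]
          · exact hv a (by simp at ha ⊢; tauto)
        rw [List.append_assoc, List.cons_append, fillWord_append_cons g hu hv', hupd _ hiu,
          Function.update_of_ne hmi, ihv (fun a ha => hk a (by simp at ha ⊢; tauto)) c y rfl]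
    · cases c with
      | nil =>
        simp only [List.nil_append, List.cons.injEq] at hc2
        obtain ⟨rfl, rfl⟩ := hc2
        simp only [List.append_nil] at hc1
        subst hc1
        rw [fillWord_append_cons g hu (by simpa using ⟨hmk, hv⟩), hupd _ hmu, hupd _ hmv,
          fillWord_cons_max g k y hnv (fun a ha => hk a (by simp [ha])), Function.update_self]
      | cons b c =>
        simp only [List.cons_append, List.cons.injEq] at hc2
        obtain ⟨rfl, rfl⟩ := hc2
        subst hc1
        have hiv : i ∉ v := fun h => hd i (by simp) i h rfl
        have hmi : m ≠ i := fun h => hmu (by simp [h])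
        have hu' : ∀ a ∈ x ++ i :: k :: c, m < a := by
          intro a ha
          by_cases hak : a = k
          · rwa [hak]
          · exact hu a (by simp at ha ⊢; tauto)
        have e : x ++ i :: k :: (c ++ m :: v) = (x ++ i :: k :: c) ++ m :: v := by simp
        rw [e, fillWord_append_cons g hu' hv, hupd _ hiv,
          Function.update_of_ne hmi, ihu (fun a ha => hk a (by simp at ha ⊢; tauto)) x c rfl]

end Words

end LeafForest

namespace LeafForest

/-! ### Normal forms of cycles and the count of orbits -/

section Cycles

variable {n : ℕ}

/-- `σ` sends each element of `l` to the next one, and the last one to `e`. -/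
def IsPath {α : Type*} (σ : Equiv.Perm α) : List α → α → Prop
  | [], _ => True
  | a :: l, e => σ a = l.headD e ∧ IsPath σ l e

theorem isPath_append {α : Type*} (σ : Equiv.Perm α) (u v : List α) (e : α) :
    IsPath σ (u ++ v) e ↔ IsPath σ u (v.headD e) ∧ IsPath σ v e := by
  induction u with
  | nil => simp [IsPath]
  | cons a u ih =>
    have : (u ++ v).headD e = u.headD (v.headD e) := by cases u <;> simp
    simp only [List.cons_append, IsPath, ih, this, and_assoc]

theorem isPath_map {α β : Type*} (σ : Equiv.Perm α) (τ : Equiv.Perm β) (f : α → β) (l : List α)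
    (e : α) (h : ∀ a ∈ l, τ (f a) = f (σ a)) (hl : IsPath σ l e) :
    IsPath τ (l.map f) (f e) := by
  induction l with
  | nil => trivial
  | cons a l ih =>
    refine ⟨?_, ih (fun b hb => h b (by simp [hb])) hl.2⟩
    rw [h a (by simp), hl.1]
    cases l <;> simp

theorem isPath_iterate {α : Type*} (σ : Equiv.Perm α) (a : α) (k : ℕ) :
    IsPath σ (List.iterate σ a k) (σ^[k] a) := by
  induction k generalizing a with
  | zero => trivial
  | succ k ih =>
    refine ⟨?_, ih (σ a)⟩
    cases k <;> simp

theorem IsPath.eq_iterate {α : Type*} {σ : Equiv.Perm α} {l : List α} {e : α}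
    (h : IsPath σ l e) : l = List.iterate σ (l.headD e) l.length := by
  induction l with
  | nil => rfl
  | cons a l ih =>
    have := ih h.2
    rw [← h.1] at this
    simpa using this

theorem IsPath.apply_mem {α : Type*} {σ : Equiv.Perm α} {l : List α} {e a : α}
    (h : IsPath σ l e) (ha : a ∈ l) : σ a ∈ l ∨ σ a = e := by
  induction l with
  | nil => simp at ha
  | cons b l ih =>
    rcases List.mem_cons.1 ha with rfl | ha
    · rw [h.1]
      cases l <;> simp
    · rcases ih h.2 ha with h' | h'
      · exact Or.inl (List.mem_cons_of_mem _ h')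
      · exact Or.inr h'

/-- `i τ` is the normal form of the cycle of `σ` at `i`. -/
def IsCycleList {α : Type*} (σ : Equiv.Perm α) (i : α) (τ : List α) : Prop :=
  (i :: τ).Nodup ∧ IsPath σ (i :: τ) i

theorem exists_isCycleList {α : Type*} [Finite α] (σ : Equiv.Perm α) (i : α) :
    ∃ τ, IsCycleList σ i τ := by
  have hp : 0 < Function.minimalPeriod σ i :=
    Function.minimalPeriod_pos_of_mem_periodicPts (σ.injective.mem_periodicPts i)
  obtain ⟨k, hk⟩ := Nat.exists_eq_succ_of_ne_zero hp.ne'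
  -- Iterates of `i` below the minimal period are distinct, and the next one returns to `i`.
  refine ⟨List.iterate σ (σ i) k, ?_, ?_⟩
  · have e : i :: List.iterate σ (σ i) k = List.iterate σ i (Function.minimalPeriod σ i) := by
      rw [hk]; rfl
    rw [e, ← List.range_map_iterate]
    refine List.Nodup.map_on ?_ List.nodup_range
    intro a ha b hb hab
    exact Function.iterate_injOn_Iio_minimalPeriod (List.mem_range.1 ha) (List.mem_range.1 hb) hab
  · have h := isPath_iterate σ i (Function.minimalPeriod σ i)
    rw [Function.iterate_minimalPeriod, hk] at h
    exact h

/-- The list is closed under `σ`, because its last element returns to `i`; conversely, a path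
consists of iterates of its head. -/
theorem IsCycleList.sameCycle_iff {α : Type*} [Finite α] {σ : Equiv.Perm α} {i : α} {τ : List α}
    (h : IsCycleList σ i τ) (j : α) : σ.SameCycle i j ↔ j ∈ i :: τ := by
  constructor
  · intro hj
    obtain ⟨k, -, rfl⟩ := hj.exists_pow_eq'
    induction k with
    | zero => simp
    | succ k ih =>
      have hs : σ.SameCycle i ((σ ^ k) i) := Equiv.Perm.sameCycle_pow_right.2 (.refl _ _)
      rw [pow_succ', Equiv.Perm.mul_apply]
      rcases h.2.apply_mem (ih hs) with h' | h'
      · exact h'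
      · rw [h']; simp
  · intro hj
    rw [h.2.eq_iterate, List.mem_iterate] at hj
    obtain ⟨k, -, rfl⟩ := hj
    rw [Equiv.Perm.iterate_eq_pow]
    exact Equiv.Perm.sameCycle_pow_right.2 (.refl _ _)

theorem IsCycleList.orbit_eq {σ : Equiv.Perm (Fin n)} {i : Fin n} {τ : List (Fin n)}
    (h : IsCycleList σ i τ) : orbit σ i = (i :: τ).toFinset := by
  ext j
  rw [orbit, Finset.mem_filter, List.mem_toFinset, h.sameCycle_iff]
  simp

/-- `σ.toList i` is empty, not `[i]`, when `i` is fixed; taking the tail makes both cases agree. -/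
theorem IsCycleList.tail_toList {σ : Equiv.Perm (Fin n)} {i : Fin n} {τ : List (Fin n)}
    (h : IsCycleList σ i τ) : (σ.toList i).tail = τ := by
  by_cases hi : i ∈ σ.support
  · have hc : (σ.cycleOf i).support.card = (i :: τ).length := by
      rw [← List.toFinset_card_of_nodup h.1, ← h.orbit_eq]
      congr 1
      ext j
      rw [Equiv.Perm.mem_support_cycleOf_iff, orbit]
      simp [Equiv.Perm.mem_support.1 hi]
    have := h.2.eq_iterate
    rw [← hc] at this
    -- By definition `toList` lists as many iterates of `i` as the support of its cycle has
    -- elements.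
    have e : σ.toList i = i :: τ := this.symm
    rw [e, List.tail_cons]
  · rw [Equiv.Perm.toList_eq_nil_iff.2 hi]
    rw [Equiv.Perm.mem_support, not_not] at hi
    cases τ with
    | nil => rfl
    | cons a τ =>
      have h1 := h.2.1
      rw [hi] at h1
      have h2 := h.1
      simp at h1 h2
      tauto

theorem IsCycleList.cycleWord_eq {σ : Equiv.Perm (Fin n)} {i : Fin n} {τ : List (Fin n)}
    (h : IsCycleList σ i τ) : cycleWord σ i = τ.map fun j : Fin n => (j : ℕ) + 1 := by
  rw [cycleWord, h.tail_toList]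
  simp [← List.map_eq_flatMap, Function.comp_def]

/-- Each orbit contains exactly one element of `orbitMins σ`, its minimum. -/
theorem numOrbits_eq_length (σ : Equiv.Perm (Fin n)) : numOrbits σ = (orbitMins σ).length := by
  classical
  have hrel : ∀ a b : Fin n, (MulAction.orbitRel (Subgroup.zpowers σ) (Fin n)) a b ↔
      σ.SameCycle a b := by
    intro a b
    rw [MulAction.orbitRel_apply, MulAction.mem_orbit_iff, Equiv.Perm.sameCycle_comm]
    constructor
    · rintro ⟨⟨_, k, rfl⟩, h⟩
      exact ⟨k, h⟩
    · rintro ⟨k, h⟩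
      exact ⟨⟨σ ^ k, k, rfl⟩, h⟩
  have hnd : (orbitMins σ).Nodup := (List.nodup_finRange n).filter _
  rw [numOrbits, ← List.toFinset_card_of_nodup hnd, ← Nat.card_eq_finsetCard]
  have hmem : ∀ i, i ∈ (orbitMins σ).toFinset ↔ ∀ j, σ.SameCycle i j → i ≤ j := by
    intro i
    simp [orbitMins, orbit]
  symm
  refine Nat.card_congr (Equiv.ofBijective (fun i : (orbitMins σ).toFinset =>
    (Quotient.mk'' i.1 : MulAction.orbitRel.Quotient (Subgroup.zpowers σ) (Fin n))) ⟨?_, ?_⟩)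
  · rintro ⟨i, hi⟩ ⟨j, hj⟩ h
    have hij : σ.SameCycle i j := (hrel i j).1 (Quotient.eq''.1 h)
    exact Subtype.ext (le_antisymm ((hmem i).1 hi j hij) ((hmem j).1 hj i hij.symm))
  · intro q
    induction q using Quotient.inductionOn' with
    | h i =>
      have hm := Finset.min'_mem (orbit σ i) ⟨i, mem_orbit_self σ i⟩
      set m := (orbit σ i).min' ⟨i, mem_orbit_self σ i⟩ with hmdef
      have him : σ.SameCycle i m := (Finset.mem_filter.1 hm).2
      refine ⟨⟨m, (hmem m).2 fun j hj => Finset.min'_le _ _ ?_⟩, ?_⟩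
      · exact Finset.mem_filter.2 ⟨Finset.mem_univ j, him.trans hj⟩
      · exact Quotient.eq''.2 ((hrel m i).2 him.symm)

end Cycles

end LeafForest

namespace LeafForest

/-! ### Building permutations of `n + 1` points from permutations of `n` points -/

section Insertion

variable {n : ℕ}

/-- The permutation of `Fin (n + 1)` that extends `σ` and fixes the last element. -/
def extendLast (σ : Equiv.Perm (Fin n)) : Equiv.Perm (Fin (n + 1)) :=
  finSuccEquivLast.symm.permCongr σ.optionCongr

/-- The permutation of `Fin (n + 1)` obtained from `σ` by inserting the last element right after
`j` in its cycle. -/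
def insertLast (σ : Equiv.Perm (Fin n)) (j : Fin n) : Equiv.Perm (Fin (n + 1)) :=
  extendLast σ * Equiv.swap j.castSucc (Fin.last n)

theorem extendLast_castSucc (σ : Equiv.Perm (Fin n)) (a : Fin n) :
    extendLast σ a.castSucc = (σ a).castSucc := by
  simp [extendLast, Equiv.permCongr_apply]

theorem extendLast_last (σ : Equiv.Perm (Fin n)) : extendLast σ (Fin.last n) = Fin.last n := by
  simp [extendLast, Equiv.permCongr_apply]

theorem insertLast_self (σ : Equiv.Perm (Fin n)) (j : Fin n) :
    insertLast σ j j.castSucc = Fin.last n := by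
  simp [insertLast, extendLast_last]

theorem insertLast_last (σ : Equiv.Perm (Fin n)) (j : Fin n) :
    insertLast σ j (Fin.last n) = (σ j).castSucc := by
  simp [insertLast, extendLast_castSucc]

theorem insertLast_of_ne (σ : Equiv.Perm (Fin n)) {j a : Fin n} (h : a ≠ j) :
    insertLast σ j a.castSucc = (σ a).castSucc := by
  rw [insertLast, Equiv.Perm.mul_apply, Equiv.swap_apply_of_ne_of_ne, extendLast_castSucc]
  · simpa using h
  · exact (Fin.castSucc_lt_last a).ne

theorem sum_perm_succ {M : Type*} [AddCommMonoid M] (f : Equiv.Perm (Fin (n + 1)) → M) :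
    ∑ ρ, f ρ = ∑ σ : Equiv.Perm (Fin n), (f (extendLast σ) + ∑ j, f (insertLast σ j)) := by
  rw [← Equiv.sum_comp (finSuccEquivLast (n := n)).symm.permCongr,
    ← Equiv.sum_comp Equiv.Perm.decomposeOption.symm, Fintype.sum_prod_type_right]
  refine Finset.sum_congr rfl fun σ _ => ?_
  rw [Fintype.sum_option]
  congr 1
  · simp [extendLast]
    rfl
  -- `decomposeOption` records the image of the last point, which for `insertLast σ j` is `σ j`;
  -- hence the reindexing by `σ`.
  · rw [← Equiv.sum_comp σ]
    refine Finset.sum_congr rfl fun j _ => ?_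
    congr 1
    ext a : 1
    induction a using Fin.lastCases with
    | last => simp [insertLast_last, Equiv.permCongr_apply]
    | cast a =>
      by_cases h : a = j
      · subst h
        simp [insertLast_self, Equiv.permCongr_apply]
      · have h' : σ a ≠ σ j := fun e => h (σ.injective e)
        rw [insertLast_of_ne σ h]
        simp only [Equiv.permCongr_apply, Equiv.symm_symm, finSuccEquivLast_castSucc,
          Equiv.Perm.decomposeOption_symm_apply, Equiv.Perm.mul_apply, Equiv.optionCongr_apply,
          Option.map_some]
        rw [Equiv.swap_apply_of_ne_of_ne (by simp) (by simpa using h'),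
          finSuccEquivLast_symm_some]

theorem nodup_map_castSucc {l : List (Fin n)} (h : l.Nodup) : (l.map Fin.castSucc).Nodup :=
  h.map (Fin.castSucc_injective n)

theorem isCycleList_extendLast {σ : Equiv.Perm (Fin n)} {i : Fin n} {τ : List (Fin n)}
    (h : IsCycleList σ i τ) :
    IsCycleList (extendLast σ) i.castSucc (τ.map Fin.castSucc) :=
  ⟨nodup_map_castSucc h.1,
    isPath_map σ _ Fin.castSucc (i :: τ) i (fun a _ => extendLast_castSucc σ a) h.2⟩

theorem isCycleList_extendLast_last (σ : Equiv.Perm (Fin n)) :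
    IsCycleList (extendLast σ) (Fin.last n) [] :=
  ⟨by simp, extendLast_last σ, trivial⟩

theorem isCycleList_insertLast_of_notMem {σ : Equiv.Perm (Fin n)} {i j : Fin n} {τ : List (Fin n)}
    (h : IsCycleList σ i τ) (hj : j ∉ i :: τ) :
    IsCycleList (insertLast σ j) i.castSucc (τ.map Fin.castSucc) :=
  ⟨nodup_map_castSucc h.1, isPath_map σ _ Fin.castSucc (i :: τ) i
    (fun a ha => insertLast_of_ne σ (by rintro rfl; exact hj ha)) h.2⟩

theorem nodup_insertLast {x y : List (Fin n)} {j : Fin n} (h : (x ++ j :: y).Nodup) :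
    (x.map Fin.castSucc ++ j.castSucc :: Fin.last n :: y.map Fin.castSucc).Nodup := by
  have e : x.map Fin.castSucc ++ j.castSucc :: Fin.last n :: y.map Fin.castSucc =
      (x ++ [j]).map Fin.castSucc ++ Fin.last n :: y.map Fin.castSucc := by simp
  rw [e, List.nodup_middle, List.nodup_cons, ← List.map_append]
  refine ⟨?_, nodup_map_castSucc (by simpa using h)⟩
  rw [List.mem_map]
  rintro ⟨a, -, ha⟩
  exact (Fin.castSucc_lt_last a).ne ha

/-- Only the arrow out of `j` changes: it now passes through the last point before reaching `σ j`.
Absence of repetitions keeps `j` out of `x` and `y`. -/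
theorem isPath_insertLast {σ : Equiv.Perm (Fin n)} {i j : Fin n} {x y : List (Fin n)}
    (hn : (x ++ j :: y).Nodup) (h : IsPath σ (x ++ j :: y) i) :
    IsPath (insertLast σ j) (x.map Fin.castSucc ++ j.castSucc :: Fin.last n :: y.map Fin.castSucc)
      i.castSucc := by
  rw [List.nodup_middle, List.nodup_cons, List.mem_append, not_or] at hn
  rw [isPath_append] at h ⊢
  refine ⟨isPath_map σ _ Fin.castSucc x j (fun a ha => insertLast_of_ne σ ?_) h.1,
    insertLast_self σ j, ?_,
    isPath_map σ _ Fin.castSucc y i (fun a ha => insertLast_of_ne σ ?_) h.2.2⟩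
  · rintro rfl; exact hn.1.1 ha
  · rw [insertLast_last, h.2.1]
    cases y <;> simp
  · rintro rfl; exact hn.1.2 ha

theorem isCycleList_insertLast_self {σ : Equiv.Perm (Fin n)} {i : Fin n} {τ : List (Fin n)}
    (h : IsCycleList σ i τ) :
    IsCycleList (insertLast σ i) i.castSucc (Fin.last n :: τ.map Fin.castSucc) :=
  ⟨nodup_insertLast (x := []) h.1, isPath_insertLast (x := []) h.1 h.2⟩

theorem isCycleList_insertLast_mid {σ : Equiv.Perm (Fin n)} {i j : Fin n} {x y : List (Fin n)}
    (h : IsCycleList σ i (x ++ j :: y)) :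
    IsCycleList (insertLast σ j) i.castSucc
      (x.map Fin.castSucc ++ j.castSucc :: Fin.last n :: y.map Fin.castSucc) :=
  ⟨nodup_insertLast (x := i :: x) h.1, isPath_insertLast (x := i :: x) h.1 h.2⟩

theorem sameCycle_extendLast_castSucc (σ : Equiv.Perm (Fin n)) (i b : Fin n) :
    (extendLast σ).SameCycle i.castSucc b.castSucc ↔ σ.SameCycle i b := by
  obtain ⟨τ, h⟩ := exists_isCycleList σ i
  rw [h.sameCycle_iff, (isCycleList_extendLast h).sameCycle_iff]
  simp

theorem sameCycle_insertLast_castSucc (σ : Equiv.Perm (Fin n)) (j i b : Fin n) :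
    (insertLast σ j).SameCycle i.castSucc b.castSucc ↔ σ.SameCycle i b := by
  obtain ⟨τ, h⟩ := exists_isCycleList σ i
  have hb : b.castSucc ≠ Fin.last n := (Fin.castSucc_lt_last b).ne
  rw [h.sameCycle_iff]
  by_cases hj : j ∈ i :: τ
  · rcases List.mem_cons.1 hj with rfl | hj
    · rw [(isCycleList_insertLast_self h).sameCycle_iff]
      simp [hb]
    · obtain ⟨x, y, rfl⟩ := List.append_of_mem hj
      rw [(isCycleList_insertLast_mid h).sameCycle_iff]
      simp [hb]
  · rw [(isCycleList_insertLast_of_notMem h hj).sameCycle_iff]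
    simp

theorem orbitMins_eq_filter (σ : Equiv.Perm (Fin n)) [DecidablePred fun i =>
    ∀ j, σ.SameCycle i j → i ≤ j] :
    orbitMins σ = (List.finRange n).filter fun i => ∀ j, σ.SameCycle i j → i ≤ j := by
  unfold orbitMins
  refine List.filter_congr fun i _ => ?_
  simp [orbit]

/-- The last point is an orbit by itself and exceeds all other minima, so it comes at the end. -/
theorem orbitMins_extendLast (σ : Equiv.Perm (Fin n)) :
    orbitMins (extendLast σ) = (orbitMins σ).map Fin.castSucc ++ [Fin.last n] := by
  classical
  rw [orbitMins_eq_filter, orbitMins_eq_filter, List.finRange_succ_last, List.filter_append,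
    List.filter_map]
  congr 1
  · congr 1
    refine List.filter_congr fun i _ => ?_
    simp only [Function.comp_apply, Fin.forall_fin_succ',
      sameCycle_extendLast_castSucc, Fin.castSucc_le_castSucc_iff, Fin.le_last, implies_true,
      and_true]
  · rw [List.filter_singleton, cond_eq_ite, if_pos]
    simp only [decide_eq_true_eq]
    intro j hj
    rw [(isCycleList_extendLast_last σ).sameCycle_iff] at hj
    simp at hj
    exact hj.ge

/-- The last point shares its orbit with the smaller point `σ j`, so it is never a minimum, and the
orbits are otherwise unchanged. -/
theorem orbitMins_insertLast (σ : Equiv.Perm (Fin n)) (j : Fin n) :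
    orbitMins (insertLast σ j) = (orbitMins σ).map Fin.castSucc := by
  classical
  rw [orbitMins_eq_filter, orbitMins_eq_filter, List.finRange_succ_last, List.filter_append,
    List.filter_map, List.filter_singleton, cond_eq_ite, if_neg, List.append_nil]
  · congr 1
    refine List.filter_congr fun i _ => ?_
    simp only [Function.comp_apply, Fin.forall_fin_succ',
      sameCycle_insertLast_castSucc, Fin.castSucc_le_castSucc_iff, Fin.le_last, implies_true,
      and_true]
  · simp only [decide_eq_true_eq]
    intro h
    have := h (σ j).castSucc ⟨1, by simp [insertLast_last]⟩
    exact absurd (Fin.castSucc_lt_last (σ j)) (not_lt.2 this)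

end Insertion

/-! ### The forest attached to a permutation -/

section PermTrees

variable {X : Type*} {n : ℕ}

/-- `Φₙ(T₀ ⋯ Tₙ₋₁)(σ)` for the sequence of trees `Tᵢ = g i`. -/
def permTrees (g : ℕ → LeafTree X) (σ : Equiv.Perm (Fin n)) : Forest X :=
  (orbitMins σ).map fun i => fillWord (fun a => g (a - 1)) (cycleWord σ i) (g i)

theorem permTrees_extendLast (g : ℕ → LeafTree X) (σ : Equiv.Perm (Fin n)) :
    permTrees g (extendLast σ) = permTrees g σ ++ [g n] := by
  rw [permTrees, permTrees, orbitMins_extendLast, List.map_append, List.map_map]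
  congr 1
  · refine List.map_congr_left fun i _ => ?_
    obtain ⟨τ, h⟩ := exists_isCycleList σ i
    rw [Function.comp_apply, h.cycleWord_eq, (isCycleList_extendLast h).cycleWord_eq]
    simp [Function.comp_def]
  · rw [List.map_singleton, (isCycleList_extendLast_last σ).cycleWord_eq]
    simp [fillWord_nil]

/-- The new letter `n + 1` is the largest one. It opens the word when `j` is the minimum of its
orbit, and otherwise follows the letter `j + 1`; the two insertion lemmas for `fillWord` treat these
cases. Words of the other orbits do not see the update. -/
theorem permTrees_insertLast (g : ℕ → LeafTree X) (σ : Equiv.Perm (Fin n)) (j : Fin n) :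
    permTrees g (insertLast σ j) = permTrees (Function.update g j (g j * g n)) σ := by
  rw [permTrees, permTrees, orbitMins_insertLast, List.map_map]
  refine List.map_congr_left fun i _ => ?_
  obtain ⟨τ, h⟩ := exists_isCycleList σ i
  rw [Function.comp_apply, h.cycleWord_eq]
  have hnd : (τ.map fun k : Fin n => (k : ℕ) + 1).Nodup := by
    refine List.Nodup.map ?_ (List.nodup_cons.1 h.1).2
    intro a b hab
    exact Fin.ext (by simpa using hab)
  have hlt : ∀ a ∈ τ.map (fun k : Fin n => (k : ℕ) + 1), a < n + 1 := by
    intro a ha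
    obtain ⟨k, -, rfl⟩ := List.mem_map.1 ha
    have := k.2
    omega
  have hcongr : j ∉ τ → ∀ t, fillWord (fun a => Function.update g j (g j * g n) (a - 1))
      (τ.map fun k : Fin n => (k : ℕ) + 1) t = fillWord (fun a => g (a - 1))
        (τ.map fun k : Fin n => (k : ℕ) + 1) t := by
    intro hj t
    refine fillWord_congr t fun a ha => Function.update_of_ne ?_ _ _
    obtain ⟨k, hk, rfl⟩ := List.mem_map.1 ha
    intro e
    have : k = j := Fin.ext (by simpa using e)
    exact hj (this ▸ hk)
  by_cases hj : j ∈ i :: τ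
  · rcases List.mem_cons.1 hj with rfl | hj
    · rw [(isCycleList_insertLast_self h).cycleWord_eq, hcongr (List.nodup_cons.1 h.1).1]
      simpa [Function.comp_def] using
        fillWord_cons_max (fun a => g (a - 1)) (n + 1) _ hnd hlt (g j)
    · have hij : (i : ℕ) ≠ j := by
        intro e
        exact (List.nodup_cons.1 h.1).1 (Fin.ext e ▸ hj)
      obtain ⟨x, y, rfl⟩ := List.append_of_mem hj
      rw [(isCycleList_insertLast_mid h).cycleWord_eq, Function.update_of_ne hij]
      have key := fillWord_insert_max (fun a => g (a - 1)) (n + 1) (j + 1) _ hnd hlt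
        (x.map fun k : Fin n => (k : ℕ) + 1) (y.map fun k : Fin n => (k : ℕ) + 1) (by simp) (g i)
      have e : Function.update (fun a => g (a - 1)) ((j : ℕ) + 1)
          (g ((j : ℕ) + 1 - 1) * g (n + 1 - 1)) =
          Function.update (fun a => g (a - 1)) ((j : ℕ) + 1) (g j * g n) := by simp
      simp only [e] at key
      simp only [List.map_append, List.map_cons, List.map_map, Function.comp_def,
        Fin.val_castSucc, Fin.val_last] at key ⊢
      rw [key]
      refine fillWord_congr _ fun a ha => ?_
      -- Updating at `j` before the shift or at `j + 1` after it gives the same value at `a`, except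
      -- possibly at `a = 0`, where `a - 1` truncates to `0`.
      have ha0 : a ≠ 0 := by
        rintro rfl
        simp at ha
      obtain ⟨b, rfl⟩ := Nat.exists_eq_succ_of_ne_zero ha0
      simp [Function.update_apply]
  · rw [(isCycleList_insertLast_of_notMem h hj).cycleWord_eq]
    rw [List.mem_cons, not_or] at hj
    rw [hcongr hj.2, Function.update_of_ne fun e => hj.1 (Fin.ext e).symm]
    simp [Function.comp_def]

/-- The filtered list is increasing, so the entries before `j` are exactly the elements of `O` below
`j`. -/
theorem getElem?_filter_finRange (O : Finset (Fin n)) (j : Fin n) (hj : j ∈ O) :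
    ((List.finRange n).filter (· ∈ O))[(O.filter (· < j)).card]? = some j := by
  have hs : ((List.finRange n).filter (· ∈ O)).Pairwise (· < ·) :=
    (List.pairwise_lt_finRange n).filter _
  have hmem : ∀ a, a ∈ (List.finRange n).filter (· ∈ O) ↔ a ∈ O := by simp
  generalize (List.finRange n).filter (· ∈ O) = L at hs hmem
  obtain ⟨u, v, rfl⟩ := List.append_of_mem ((hmem j).2 hj)
  rw [List.pairwise_append, List.pairwise_cons] at hs
  obtain ⟨hu, ⟨hv, -⟩, huv⟩ := hs
  have e : O.filter (· < j) = u.toFinset := by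
    ext a
    rw [Finset.mem_filter, ← hmem, List.mem_toFinset, List.mem_append, List.mem_cons]
    constructor
    · rintro ⟨h | rfl | h, ha⟩
      · exact h
      · exact absurd ha (lt_irrefl _)
      · exact absurd ha (hv a h).not_gt
    · exact fun h => ⟨Or.inl h, huv a h j (by simp)⟩
  rw [e, List.toFinset_card_of_nodup (hu.imp fun h => h.ne)]
  simp

/-- Passing to the subforest and normalising the labels cancel: both replace an element of the orbit
by its rank. Indexing the trees by a sequence `g` on `ℕ` frees `σ` from a type that depends on the
forest. -/
theorem permForest_eq_permTrees (F : Forest X) (g : ℕ → LeafTree X)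
    (hg : ∀ i : Fin F.length, g i = F.get i) (σ : Equiv.Perm (Fin F.length)) :
    permForest F σ = permTrees g σ := by
  rw [permForest, permTrees]
  refine List.map_congr_left fun i hi => ?_
  have hmin : ∀ j ∈ orbit σ i, i ≤ j := by
    simpa [orbitMins] using hi
  obtain ⟨τ, h⟩ := exists_isCycleList σ i
  have hget : ∀ j ∈ orbit σ i,
      (subforest F (orbit σ i))[((orbit σ i).filter (· < j)).card]? = some (g j) := by
    intro j hj
    rw [subforest, List.getElem?_map, getElem?_filter_finRange _ j hj, hg]
    rfl
  have hhead : (subforest F (orbit σ i)).head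
      (subforest_ne_nil F _ i (mem_orbit_self σ i)) = g i := by
    have h0 : ((orbit σ i).filter (· < i)).card = 0 := by
      rw [Finset.card_eq_zero, Finset.filter_eq_empty_iff]
      exact fun j hj => (hmin j hj).not_gt
    have := hget i (mem_orbit_self σ i)
    rw [h0, ← List.head?_eq_getElem?] at this
    exact Option.some.inj ((List.head?_eq_some_head _).symm.trans this)
  have hinj : Function.Injective fun k : Fin F.length => (k : ℕ) + 1 :=
    fun a b hab => Fin.ext (by simpa using hab)
  have hnd : (τ.map fun k : Fin F.length => (k : ℕ) + 1).Nodup := (List.nodup_cons.1 h.1).2.map hinj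
  rw [graftLevelled, standardize, fillLeaves_map, hhead, h.cycleWord_eq, fillWord,
    labels_wordTree_eq _ hnd]
  refine fillLeaves_congr _ _ fun a ha => ?_
  rw [labels_wordTree_eq _ hnd, List.mem_toFinset] at ha
  obtain ⟨j, hj, rfl⟩ := List.mem_map.1 ha
  have hjO : j ∈ orbit σ i := by
    rw [h.orbit_eq]; simp [hj]
  -- The labels omit the minimum `i`, while the position counts strictly smaller elements and so
  -- omits `j`. Each is the set of orbit elements `≤ j` with one element removed.
  have hcard : ((τ.map fun k : Fin F.length => (k : ℕ) + 1).toFinset.filter (· ≤ (j : ℕ) + 1)).card =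
      ((orbit σ i).filter (· < j)).card := by
    have e1 : (τ.map fun k : Fin F.length => (k : ℕ) + 1).toFinset.filter (· ≤ (j : ℕ) + 1) =
        (((orbit σ i).filter (· ≤ j)).erase i).image fun k : Fin F.length => (k : ℕ) + 1 := by
      have hi' := (List.nodup_cons.1 h.1).1
      rw [h.orbit_eq]
      ext a
      simp only [Finset.mem_filter, List.mem_toFinset, List.mem_map, Finset.mem_image,
        Finset.mem_erase, List.mem_cons]
      constructor
      · rintro ⟨⟨k, hk, rfl⟩, hkj⟩
        refine ⟨k, ⟨?_, Or.inr hk, Fin.le_def.2 (by omega)⟩, rfl⟩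
        rintro rfl
        exact hi' hk
      · rintro ⟨k, ⟨hki, hk, hkj⟩, rfl⟩
        exact ⟨⟨k, hk.resolve_left hki, rfl⟩, Nat.succ_le_succ hkj⟩
    have e2 : (orbit σ i).filter (· < j) = ((orbit σ i).filter (· ≤ j)).erase j := by
      ext a
      simp only [Finset.mem_filter, Finset.mem_erase, lt_iff_le_and_ne]
      tauto
    rw [e1, e2, Finset.card_image_of_injective _ hinj, Finset.card_erase_of_mem,
      Finset.card_erase_of_mem]
    · simp [hjO]
    · simp [mem_orbit_self, hmin j hjO]
  simp only [Function.comp_apply, Nat.add_sub_cancel]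
  rw [hcard, List.getD_eq_getElem?_getD, hget j hjO]
  rfl

end PermTrees

end LeafForest

namespace LeafForest

/-! ### The induction on the length of the second forest -/

section Main

variable {K : Type*} [CommRing K] {X : Type*}

theorem graftForest_eq_foldl (F G : Forest X) : graftForest K F G =
    G.foldl (fun f T => graftOp K T f) (ofForest K F) := by
  cases G with
  | nil => rfl
  | cons S R =>
    simp only [graftForest, List.foldl_cons, graftOp_ofForest, extStar_ofTree]

theorem numOrbits_extendLast {n : ℕ} (σ : Equiv.Perm (Fin n)) :
    numOrbits (extendLast σ) = numOrbits σ + 1 := by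
  simp [numOrbits_eq_length, orbitMins_extendLast]

theorem numOrbits_insertLast {n : ℕ} (σ : Equiv.Perm (Fin n)) (j : Fin n) :
    numOrbits (insertLast σ j) = numOrbits σ := by
  simp [numOrbits_eq_length, orbitMins_insertLast]

theorem graftTree_ofFn (n : ℕ) (g : ℕ → LeafTree X) (y : LeafTree X) :
    graftTree K (List.ofFn fun i : Fin n => g i) y =
      ∑ j : Fin n, ofForest K (List.ofFn fun i : Fin n => Function.update g j (g j * y) i) := by
  rw [graftTree]
  refine Fintype.sum_equiv (finCongr (List.length_ofFn)) _ _ fun j => ?_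
  congr 1
  refine List.ext_getElem (by simp) fun m h₁ h₂ => ?_
  simp [List.getElem_set, Function.update_apply, eq_comm]

/-- The induction runs over all sequences `g` at once, because the subtracted term changes one tree
of the forest. -/
theorem extStar_ofFn (f : TMag K X) (n : ℕ) (g : ℕ → LeafTree X) :
    extStar K X f (ofForest K (List.ofFn fun i : Fin n => g i)) =
      ∑ σ : Equiv.Perm (Fin n), (-1 : K) ^ (numOrbits σ + n) •
        (permTrees g σ).foldl (fun f T => graftOp K T f) f := by
  induction n generalizing g with
  | zero =>
    simp [ofForest_nil, extStar_one, permTrees, numOrbits_eq_length, orbitMins]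
  | succ n ih =>
    have h : (List.ofFn fun i : Fin (n + 1) => g i) = (List.ofFn fun i : Fin n => g i) ++ [g n] := by
      rw [List.ofFn_succ', List.concat_eq_append]
      rfl
    rw [h, ofForest_append, ofForest_singleton, extStar_mul_ofTree, graftOp_ofForest,
      graftTree_ofFn, map_sum, ih, map_sum, sum_perm_succ, Finset.sum_add_distrib, sub_eq_add_neg]
    congr 1
    -- Last point fixed: the exponent grows by two, and the final graft is that of `g n`.
    · refine Finset.sum_congr rfl fun σ _ => ?_
      rw [map_smul, permTrees_extendLast, List.foldl_append, numOrbits_extendLast]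
      congr 1
      ring
    -- Last point inserted after `j`: the exponent grows by one, which gives the minus sign.
    · rw [Finset.sum_comm, ← Finset.sum_neg_distrib]
      refine Finset.sum_congr rfl fun j _ => ?_
      rw [ih, ← Finset.sum_neg_distrib]
      refine Finset.sum_congr rfl fun σ _ => ?_
      rw [permTrees_insertLast, numOrbits_insertLast, ← add_assoc, pow_succ, mul_neg_one, neg_smul]

end Main

end LeafForest

theorem mainTheorem7 (K : Type*) [Field K] [CharZero K] (X : Type*) (F F' : LeafForest.Forest X) :
    LeafForest.extStar K X (LeafForest.ofForest K F) (LeafForest.ofForest K F') =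
      ∑ σ : Equiv.Perm (Fin F'.length),
        (-1 : K) ^ (LeafForest.numOrbits σ + F'.length) •
          LeafForest.graftForest K F (LeafForest.permForest F' σ) := by
  -- Extending `F'` to a sequence on `ℕ` needs some tree as a default value, and none exists when
  -- `X` is empty; a nonempty `F'` supplies its first tree.
  by_cases hX : F' = []
  · subst hX
    simp [LeafForest.ofForest_nil, LeafForest.extStar_one, LeafForest.permForest,
      LeafForest.numOrbits_eq_length, LeafForest.orbitMins, LeafForest.graftForest]
  obtain ⟨g, hg⟩ : ∃ g : ℕ → LeafForest.LeafTree X, ∀ i : Fin F'.length, g i = F'.get i := by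
    cases F' with
    | nil => exact absurd rfl hX
    | cons T R => exact ⟨fun i => (T :: R).getD i T, fun i => List.getD_eq_getElem _ _ i.2⟩
  have hF : F' = List.ofFn fun i : Fin F'.length => g i := by
    simp [hg]
  conv_lhs => rw [hF]
  rw [LeafForest.extStar_ofFn]
  refine Finset.sum_congr rfl fun σ _ => ?_
  rw [LeafForest.graftForest_eq_foldl, LeafForest.permForest_eq_permTrees F' g hg]
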